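/- **Setting.** Let $\mathcal S,\mathcal A$ be finite sets ($\mathcal A\neq\emptyset$), $P_{s,a}$ a probability distribution on $\mathcal S$ for each $(s,a)\in\mathcal S\times\mathcal A$, $r:\mathcal S\times\mathcal A\to[-r_{\max},r_{\max}]$ a reward function and $\gamma\in(0,1)$. Write $x_-:=-\min(x,0)$, $r_\gamma:=r_{\max}/(1-\gamma)$, $\mathrm p(x):=\max(-r_\gamma,\min(x,r_\gamma))$. For an integer $K\ge 1$ let $\Delta:=r_\gamma/K$, $\mathcal Z_\Delta:=\{k\Delta:k\in\mathbb Z\}\cap[-r_\gamma,r_\gamma]$, and let $\mathrm e$ be either rounding down, $\mathrm l_\Delta(x):=\max\{k\Delta: k\in\mathbb Z,\ k\Delta\le x\}$, or rounding up, $\mathrm u_\Delta(x):=\min\{k\Delta:k\in\mathbb Z,\ k\Delta\ge x\}$ (if $\Delta=0$, put $\mathrm e:=0$). For $(s,z,a)\in\mathcal S\times\mathcal Z_\Delta\times\mathcal A$ put $$\tilde r(s,z,a):=z_--(r(s,a)+z)_-,\qquad z'(s,z,a):=\mathrm p\Big(\mathrm e\Big(\tfrac{r(s,a)+z}{\gamma}\Big)\Big)\in\mathcal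 Z_\Delta .$$ Let $\hat v^{*,\mathrm e}:\mathcal S\times\mathcal Z_\Delta\to\mathbb R$ be the unique function with $$\hat v^{*,\mathrm e}(s,z)=\max_{a\in\mathcal A}\Big\{\tilde r(s,z,a)+\gamma\sum_{s'\in\mathcal S}P_{s,a}(s')\,\hat v^{*,\mathrm e}(s',z'(s,z,a))\Big\}$$ for all $(s,z)$, and let $\hat q^{*,\mathrm e}(s,z,a):=\tilde r(s,z,a)+\gamma\sum_{s'}P_{s,a}(s')\,\hat v^{*,\mathrm e}(s',z'(s,z,a))$. **Algorithm (block-update static CVaR Q-learning).** Let $\mathcal S_{\mathrm{term}}\subseteq\mathcal S$ be a (possibly empty) set of terminal states, each of them absorbing with zero reward ($P_{t,a}(t)=1$ and $r(t,a)=0$ for all $a$), $\nu$ a probability distribution on $\mathcal S\setminus\mathcal S_{\mathrm{term}}$, $\varepsilon_k\in[0,1]$ an exploration schedule and $\beta(n)\ge 0$ step sizes. Start from $\hat q^{\mathrm e}_0=0$ on $\mathcal S\times\mathcal Z_\Delta\times\mathcal A$ and $N_0=0$ on $\mathcal S\times\mathcal A$, and draw $(s_0,z_0)\sim\nu\otimes\mathrm{Unif}(\mathcal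 Z_\Delta)$. At each step $k=0,1,2,\dots$, given the past, draw $a_k$ from an $\varepsilon_k$-greedy distribution with respect to $a\mapsto\hat q^{\mathrm e}_k(s_k,z_k,a)$ (with probability $1-\varepsilon_k$ a maximizer, ties being broken arbitrarily, and with probability $\varepsilon_k$ a uniformly distributed action); then, given the past and $a_k$, draw $s_k'\sim P_{s_k,a_k}$; for every $\tilde z\in\mathcal Z_\Delta$ set $$\hat q^{\mathrm e}_{k+1}(s_k,\tilde z,a_k):=\hat q^{\mathrm e}_k(s_k,\tilde z,a_k)+\beta\big(N_k(s_k,a_k)\big)\Big(\tilde r(s_k,\tilde z,a_k)+\gamma\max_{a'\in\mathcal A}\hat q^{\mathrm e}_k\big(s_k',z'(s_k,\tilde z,a_k),a'\big)-\hat q^{\mathrm e}_k(s_k,\tilde z,a_k)\Big),$$ leave all other entries of $\hat q^{\mathrm e}_k$ unchanged, and let $N_{k+1}$ be $N_k$ with its value at $(s_k,a_k)$ increased by one. If $s_k'\notin\mathcal S_{\mathrm{term}}$, put $s_{k+1}:=s_k'$ and $z_{k+1}:=z'(s_k,z_k,a_k)$; otherwise a new episode starts, with $(s_{k+1},z_{k+1})\sim\nu\otimes\mathrm{Unif}(\mathcal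 Z_\Delta)$ drawn afresh. **Theorem.** Assume that 1. (Robbins–Monro step sizes) $\sum_{n=0}^\infty\beta(n)=\infty$ and $\sum_{n=0}^\infty\beta(n)^2<\infty$; 2. (sufficient exploration) for every non-terminal state $s$ and every $a\in\mathcal A$, $\lim_{k\to\infty}N_k(s,a)=\infty$ almost surely. Then, with probability one, $\max_{(s,z,a)\in\mathcal S\times\mathcal Z_\Delta\times\mathcal A}\big|\hat q^{\mathrm e}_k(s,z,a)-\hat q^{*,\mathrm e}(s,z,a)\big|\to 0$ as $k\to\infty$. -/

import Mathlib

open MeasureTheory Filter Topology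

/-- The data of a finite discounted Markov decision process: transition probabilities `P s a`
(an element of the probability simplex over `S`), rewards bounded by `rmax`, discount `γ`. -/
structure CvarMDP (S A : Type*) [Fintype S] where
  P : S → A → stdSimplex ℝ S
  r : S → A → ℝ
  rmax : ℝ
  γ : ℝ
  rmax_nonneg : 0 ≤ rmax
  abs_r_le : ∀ s a, |r s a| ≤ rmax
  γ_pos : 0 < γ
  γ_lt_one : γ < 1

/-- The two roundings onto the uniform grid: down (`l_Δ`) and up (`u_Δ`). -/
inductive Rounding
  | lower
  | upper

noncomputable section

/-- `l_Δ` and `u_Δ`, for a grid of mesh `Δ`. -/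
def Rounding.map (e : Rounding) (Δ x : ℝ) : ℝ :=
  match e with
  | .lower => ⌊x / Δ⌋ * Δ
  | .upper => ⌈x / Δ⌉ * Δ

theorem Rounding.isGreatest_lower {Δ : ℝ} (hΔ : 0 < Δ) (x : ℝ) :
    IsGreatest {y : ℝ | (∃ k : ℤ, y = k * Δ) ∧ y ≤ x} (Rounding.lower.map Δ x) := by
  refine ⟨⟨⟨_, rfl⟩, ?_⟩, ?_⟩
  · exact (le_div_iff₀ hΔ).1 (Int.floor_le _)
  · rintro y ⟨⟨k, rfl⟩, hk⟩
    have : k ≤ ⌊x / Δ⌋ := Int.le_floor.2 ((le_div_iff₀ hΔ).2 hk)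
    exact mul_le_mul_of_nonneg_right (by exact_mod_cast this) hΔ.le

theorem Rounding.isLeast_upper {Δ : ℝ} (hΔ : 0 < Δ) (x : ℝ) :
    IsLeast {y : ℝ | (∃ k : ℤ, y = k * Δ) ∧ x ≤ y} (Rounding.upper.map Δ x) := by
  refine ⟨⟨⟨_, rfl⟩, ?_⟩, ?_⟩
  · exact (div_le_iff₀ hΔ).1 (Int.le_ceil _)
  · rintro y ⟨⟨k, rfl⟩, hk⟩
    have : ⌈x / Δ⌉ ≤ k := Int.ceil_le.2 ((div_le_iff₀ hΔ).2 hk)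
    exact mul_le_mul_of_nonneg_right (by exact_mod_cast this) hΔ.le

theorem Rounding.map_eq (e : Rounding) (Δ x : ℝ) : ∃ k : ℤ, e.map Δ x = k * Δ := by
  cases e
  · exact ⟨_, rfl⟩
  · exact ⟨_, rfl⟩

namespace CvarMDP

variable {S A : Type*} [Fintype S]

/-- `r_γ = r_max / (1 - γ)`. -/
def rγ (M : CvarMDP S A) : ℝ := M.rmax / (1 - M.γ)

/-- `Δ = r_γ / K`. -/
def mesh (M : CvarMDP S A) (K : ℕ+) : ℝ := M.rγ / (K : ℕ)

/-- The projection `p` of `ℝ` onto `[-r_γ, r_γ]`. -/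
def proj (M : CvarMDP S A) (x : ℝ) : ℝ := max (-M.rγ) (min x M.rγ)

/-- The grid `Z_Δ = {kΔ : k ∈ ℤ} ∩ [-r_γ, r_γ]`. -/
def grid (M : CvarMDP S A) (K : ℕ+) : Set ℝ :=
  {x | ∃ k : ℤ, x = k * M.mesh K} ∩ Set.Icc (-M.rγ) M.rγ

theorem rγ_nonneg (M : CvarMDP S A) : 0 ≤ M.rγ :=
  div_nonneg M.rmax_nonneg (sub_nonneg.2 M.γ_lt_one.le)

theorem mesh_nonneg (M : CvarMDP S A) (K : ℕ+) : 0 ≤ M.mesh K :=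
  div_nonneg M.rγ_nonneg (Nat.cast_nonneg _)

theorem K_mul_mesh (M : CvarMDP S A) (K : ℕ+) : ((K : ℕ) : ℝ) * M.mesh K = M.rγ :=
  mul_div_cancel₀ _ (Nat.cast_ne_zero.2 K.ne_zero)

theorem grid_finite (M : CvarMDP S A) (K : ℕ+) : (M.grid K).Finite := by
  refine ((Set.finite_Icc (-(K : ℕ) : ℤ) (K : ℕ)).image fun k : ℤ => (k : ℝ) * M.mesh K).subset ?_
  rintro x ⟨⟨k, rfl⟩, h₁, h₂⟩
  rcases (M.mesh_nonneg K).eq_or_lt with h | h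
  · exact ⟨0, by simp, by simp [← h]⟩
  · rw [← M.K_mul_mesh K] at h₁ h₂
    refine ⟨k, ⟨?_, ?_⟩, rfl⟩
    · have : (-(K : ℕ) : ℝ) ≤ k := by
        refine le_of_mul_le_mul_right ?_ h
        simpa using h₁
      exact_mod_cast this
    · have : (k : ℝ) ≤ (K : ℕ) := le_of_mul_le_mul_right h₂ h
      exact_mod_cast this

instance instFintypeGrid (M : CvarMDP S A) (K : ℕ+) : Fintype (M.grid K) :=
  (M.grid_finite K).fintype

theorem proj_map_mem_grid (M : CvarMDP S A) (K : ℕ+) (e : Rounding) (x : ℝ) :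
    M.proj (e.map (M.mesh K) x) ∈ M.grid K := by
  obtain ⟨k, hk⟩ := e.map_eq (M.mesh K) x
  refine ⟨⟨max (-(K : ℕ)) (min k (K : ℕ)), ?_⟩, le_max_left _ _, ?_⟩
  · rw [proj, hk, ← M.K_mul_mesh K]
    push_cast
    rw [max_mul_of_nonneg _ _ (M.mesh_nonneg K), min_mul_of_nonneg _ _ (M.mesh_nonneg K), neg_mul]
  · exact max_le (by linarith [M.rγ_nonneg]) (min_le_right _ _)

/-- The next budget `p(e((r(s,a) + z)/γ))`. -/
def nextBudget (M : CvarMDP S A) (K : ℕ+) (e : Rounding) (s : S) (z : M.grid K) (a : A) :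
    M.grid K :=
  ⟨M.proj (e.map (M.mesh K) ((M.r s a + z) / M.γ)), M.proj_map_mem_grid K e _⟩

/-- The augmented reward `z_- - (r(s,a) + z)_-`. -/
def augReward (M : CvarMDP S A) (s : S) (z : ℝ) (a : A) : ℝ := z⁻ - (M.r s a + z)⁻

/-- The one-step lookahead of a value function `v` on `S × Z_Δ`. -/
def lookahead (M : CvarMDP S A) (K : ℕ+) (e : Rounding) (v : S × M.grid K → ℝ) :
    S × M.grid K × A → ℝ :=
  fun x => M.augReward x.1 x.2.1 x.2.2
    + M.γ * ∑ s' : S, (M.P x.1 x.2.2) s' * v (s', M.nextBudget K e x.1 x.2.1 x.2.2)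

theorem lookahead_le_add (M : CvarMDP S A) (K : ℕ+) (e : Rounding) (v w : S × M.grid K → ℝ)
    (x : S × M.grid K × A) :
    M.lookahead K e v x ≤ M.lookahead K e w x + M.γ * dist v w := by
  have h0 := (M.P x.1 x.2.2).2
  have h : ∑ s' : S, (M.P x.1 x.2.2) s' * v (s', M.nextBudget K e x.1 x.2.1 x.2.2)
      ≤ ∑ s' : S, (M.P x.1 x.2.2) s' * w (s', M.nextBudget K e x.1 x.2.1 x.2.2)
        + dist v w := by
    calc _ ≤ ∑ s' : S, (M.P x.1 x.2.2) s'
          * (w (s', M.nextBudget K e x.1 x.2.1 x.2.2) + dist v w) := by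
          refine Finset.sum_le_sum fun s' _ => mul_le_mul_of_nonneg_left ?_ (h0.1 s')
          have := (Real.dist_eq _ _ ▸ dist_le_pi_dist v w
            (s', M.nextBudget K e x.1 x.2.1 x.2.2))
          linarith [le_abs_self (v (s', M.nextBudget K e x.1 x.2.1 x.2.2)
            - w (s', M.nextBudget K e x.1 x.2.1 x.2.2))]
      _ = _ := by
          simp_rw [mul_add]
          rw [Finset.sum_add_distrib, ← Finset.sum_mul, stdSimplex.sum_eq_one, one_mul]
  have := mul_le_mul_of_nonneg_left h M.γ_pos.le
  unfold lookahead
  linarith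

variable [Fintype A] [Nonempty A]

/-- Maximum over the finite nonempty set of actions. -/
def maxAction (f : A → ℝ) : ℝ := Finset.univ.sup' Finset.univ_nonempty f

/-- The discretized Bellman operator on functions on `S × Z_Δ`. -/
def bellman (M : CvarMDP S A) (K : ℕ+) (e : Rounding) (v : S × M.grid K → ℝ) :
    S × M.grid K → ℝ :=
  fun x => maxAction fun a => M.lookahead K e v (x.1, x.2, a)

theorem maxAction_le_add {f g : A → ℝ} {c : ℝ} (h : ∀ a, f a ≤ g a + c) :
    maxAction f ≤ maxAction g + c :=
  Finset.sup'_le _ _ fun a ha => (h a).trans (by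
    have := Finset.le_sup' g ha
    unfold maxAction
    linarith)

theorem bellman_contracting (M : CvarMDP S A) (K : ℕ+) (e : Rounding) :
    ContractingWith ⟨M.γ, M.γ_pos.le⟩ (M.bellman K e) := by
  refine ⟨by exact_mod_cast M.γ_lt_one, LipschitzWith.of_dist_le_mul fun v w => ?_⟩
  refine (dist_pi_le_iff (mul_nonneg M.γ_pos.le dist_nonneg)).2 fun x => ?_
  rw [Real.dist_eq, abs_sub_le_iff]
  constructor
  · exact sub_le_iff_le_add'.2 (maxAction_le_add fun a => M.lookahead_le_add K e v w _)
  · refine sub_le_iff_le_add'.2 (maxAction_le_add fun a => ?_)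
    rw [dist_comm]
    exact M.lookahead_le_add K e w v _

/-- The optimal value function on `S × Z_Δ`: the unique fixed point of `bellman`. -/
def optValue (M : CvarMDP S A) (K : ℕ+) (e : Rounding) : S × M.grid K → ℝ :=
  ContractingWith.fixedPoint (M.bellman K e) (M.bellman_contracting K e)

theorem bellman_eq_self_iff (M : CvarMDP S A) (K : ℕ+) (e : Rounding) (v : S × M.grid K → ℝ) :
    M.bellman K e v = v ↔ v = M.optValue K e := by
  constructor
  · exact fun h => (M.bellman_contracting K e).fixedPoint_unique h
  · rintro rfl
    exact (M.bellman_contracting K e).fixedPoint_isFixedPt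

/-- The optimal action-value function on `S × Z_Δ × A`. -/
def optQ (M : CvarMDP S A) (K : ℕ+) (e : Rounding) : S × M.grid K × A → ℝ :=
  M.lookahead K e (M.optValue K e)

/-- What the learner stores: the table `q` and the visit counts `N`. -/
structure Learner (M : CvarMDP S A) (K : ℕ+) where
  q : S × M.grid K × A → ℝ
  N : S → A → ℕ

open Classical in
/-- One block update after observing the transition `s, a → s'`: the entries `(s, z, a)` are
updated for all `z ∈ Z_Δ` at once, and the count of `(s, a)` is increased. -/
def Learner.step {M : CvarMDP S A} {K : ℕ+} (e : Rounding) (β : ℕ → ℝ) (L : M.Learner K)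
    (s : S) (a : A) (s' : S) : M.Learner K where
  q := fun x =>
    if x.1 = s ∧ x.2.2 = a then
      L.q x + β (L.N s a) * (M.augReward s x.2.1 a
        + M.γ * maxAction (fun a' => L.q (s', M.nextBudget K e s x.2.1 a, a')) - L.q x)
    else L.q x
  N := fun t b => if t = s ∧ b = a then L.N t b + 1 else L.N t b

/-- The content of the learner's memory after `k` steps along the given sequences of states,
actions and observed next states; everything is zero at the start. -/
def learner (M : CvarMDP S A) (K : ℕ+) (e : Rounding) (β : ℕ → ℝ) (s : ℕ → S) (a : ℕ → A)
    (s' : ℕ → S) : ℕ → M.Learner K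
  | 0 => ⟨fun _ => 0, fun _ _ => 0⟩
  | k + 1 => (M.learner K e β s a s' k).step e β (s k) (a k) (s' k)

/-- `μ` is an `ε`-greedy distribution for the action values `f`: with probability `1 - ε` a
maximizer of `f` (ties broken in an arbitrary way), with probability `ε` a uniform action. -/
def IsEpsGreedy (ε : ℝ) (f μ : A → ℝ) : Prop :=
  ∃ ρ : stdSimplex ℝ A, (∀ a, ρ a ≠ 0 → ∀ b, f b ≤ f a) ∧
    ∀ a, μ a = (1 - ε) * ρ a + ε / Fintype.card A

/-- The random process generated by the static CVaR Q-learning algorithm, run over infinitely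
many steps. At global step `k`, `s k` is the state, `z k` the budget, `a k` the action and `s' k`
the observed next state; `ℱ k` is the information available just before the action `a k` is drawn.
When `s' k` is terminal, the episode ends and a new one is started from `ν ⊗ Unif(Z_Δ)`. -/
structure IsQLearningRun (M : CvarMDP S A) (K : ℕ+) (e : Rounding) (terminal : Set S)
    (ν : stdSimplex ℝ S) (ε β : ℕ → ℝ) [MeasurableSpace S] [MeasurableSpace A]
    {Ω : Type*} {mΩ : MeasurableSpace Ω} (ℙ : Measure Ω) (ℱ : Filtration ℕ mΩ)
    (s : ℕ → Ω → S) (z : ℕ → Ω → M.grid K) (a : ℕ → Ω → A) (s' : ℕ → Ω → S) : Prop where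
  measurable_s : ∀ k, Measurable[ℱ k] (s k)
  measurable_z : ∀ k, Measurable[ℱ k] (z k)
  measurable_a : ∀ k, Measurable[ℱ (k + 1)] (a k)
  measurable_s' : ∀ k, Measurable[ℱ (k + 1)] (s' k)
  /-- `s 0 ∼ ν` and `z 0 ∼ Unif(Z_Δ)`, independently -/
  init : ∀ x y, ℙ.real {ω | s 0 ω = x ∧ z 0 ω = y} = ν x / Fintype.card (M.grid K)
  /-- given the past, `a k` is `ε k`-greedy for the current table at `(s k, z k)` -/
  action : ∀ k, ∀ᵐ ω ∂ℙ,
    IsEpsGreedy (ε k)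
      (fun b => (M.learner K e β (s · ω) (a · ω) (s' · ω) k).q (s k ω, z k ω, b))
      (fun b => (ℙ[Set.indicator {ω' | a k ω' = b} (fun _ => (1 : ℝ)) | ℱ k]) ω)
  /-- given the past and `a k`, `s' k ∼ P (s k) (a k)` -/
  transition : ∀ k x,
    ℙ[Set.indicator {ω | s' k ω = x} (fun _ => (1 : ℝ)) |
        ℱ k ⊔ MeasurableSpace.comap (a k) inferInstance]
      =ᵐ[ℙ] fun ω => M.P (s k ω) (a k ω) x
  /-- inside an episode, the next state and the next budget become the current ones -/
  continues : ∀ k, ∀ᵐ ω ∂ℙ, s' k ω ∉ terminal →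
    s (k + 1) ω = s' k ω ∧ z (k + 1) ω = M.nextBudget K e (s k ω) (z k ω) (a k ω)
  /-- when the episode ends, the new state and budget are drawn afresh from `ν ⊗ Unif(Z_Δ)` -/
  restarts : ∀ k x y, ∀ᵐ ω ∂ℙ, s' k ω ∈ terminal →
    (ℙ[Set.indicator {ω' | s (k + 1) ω' = x ∧ z (k + 1) ω' = y} (fun _ => (1 : ℝ)) |
        ℱ k ⊔ MeasurableSpace.comap (a k) inferInstance
          ⊔ MeasurableSpace.comap (s' k) inferInstance]) ω
      = ν x / Fintype.card (M.grid K)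

end CvarMDP

end

/-! Fix a coordinate (s, z, a). The error of the table obeys x(k+1) = x(k) + α(k) (F(k) + w(k) -
x(k)), where α(k) is the step size on visits of (s, a) and 0 otherwise. The drift satisfies |F(k)| ≤
γ‖x(k)‖ because the Bellman operator contracts in sup norm, and w(k) is the deviation of the sampled
target from its mean under P. Block updating is harmless: all budgets z share one step size and one
sampled next state, and each coordinate is handled separately.

The deterministic core is `tendsto_norm_zero_of_async_contraction`. If every series ∑ α w converges,
subtracting its tail removes the noise and leaves a weighted average of terms bounded by about γD
once ‖x‖ ≤ D. Since the weights have infinite sum, the bound D improves to any number above γD, and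
iterating this drives the error to 0.

The noise series converges almost surely because its partial sums form a martingale bounded in L²:
the noise is bounded and the squared step sizes along the visits of (s, a) sum to at most ∑ β². The
noise bound needs a trajectory-independent bound on the table (`exists_learner_q_bound`), which is
delicate only because finitely many β(n) may exceed 1. At terminal states, where no visits are
assumed, the table and the optimal values both vanish. -/

/-! ### Deterministic stochastic approximation -/

/-- A sequence of weighted averages, with weights summing to infinity, is eventually bounded by
any number larger than an eventual bound of the averaged terms. -/
theorem eventually_abs_le_of_averaging {y α δ : ℕ → ℝ} {c η : ℝ} (hα : ∀ k, 0 ≤ α k)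
    (hα_le : ∀ᶠ k in atTop, α k ≤ 1)
    (hα_sum : Tendsto (fun n => ∑ k ∈ Finset.range n, α k) atTop atTop)
    (hy : ∀ k, y (k + 1) = y k + α k * (δ k - y k)) (hδ : ∀ᶠ k in atTop, |δ k| ≤ c)
    (hη : 0 < η) : ∀ᶠ k in atTop, |y k| ≤ c + η := by
  obtain ⟨m, hm⟩ := eventually_atTop.1 (hα_le.and hδ)
  have hc : 0 ≤ c := (abs_nonneg _).trans (hm m le_rfl).2
  set σ : ℕ → ℝ := fun n => ∑ k ∈ Finset.range n, α k with hσ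
  -- Each step shrinks the excess over c by the factor 1 - α ≤ exp(-α), so the excess is governed by
  -- exp of minus the accumulated weight.
  have hbound : ∀ k ≥ m, |y k| ≤ c + |y m| * Real.exp (-(σ k - σ m)) := by
    intro k hk
    induction k, hk using Nat.le_induction with
    | base => simpa using hc
    | succ k hk ih =>
      obtain ⟨h1, h2⟩ := hm k hk
      have hs : σ (k + 1) = σ k + α k := Finset.sum_range_succ _ _
      have hexp : Real.exp (-(σ (k + 1) - σ m)) =
          Real.exp (-α k) * Real.exp (-(σ k - σ m)) := by
        rw [← Real.exp_add, hs]
        ring_nf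
      have hle : 1 - α k ≤ Real.exp (-α k) := by linarith [Real.add_one_le_exp (-α k)]
      have hstep : |y (k + 1)| ≤ (1 - α k) * |y k| + α k * |δ k| := by
        have : y (k + 1) = (1 - α k) * y k + α k * δ k := by rw [hy]; ring
        rw [this]
        refine (abs_add_le _ _).trans_eq ?_
        rw [abs_mul, abs_mul, abs_of_nonneg (hα k), abs_of_nonneg (sub_nonneg.2 h1)]
      have e1 := mul_le_mul_of_nonneg_left ih (sub_nonneg.2 h1)
      have e2 := mul_le_mul_of_nonneg_left h2 (hα k)
      have e3 := mul_le_mul_of_nonneg_right hle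
        (mul_nonneg (abs_nonneg (y m)) (Real.exp_nonneg (-(σ k - σ m))))
      rw [hexp]
      linarith
  have hlim : Tendsto (fun k => c + |y m| * Real.exp (-(σ k - σ m))) atTop (𝓝 (c + |y m| * 0)) := by
    refine tendsto_const_nhds.add (tendsto_const_nhds.mul ?_)
    exact Real.tendsto_exp_neg_atTop_nhds_zero.comp
      (tendsto_atTop_add_const_right _ (-σ m) hα_sum)
  filter_upwards [eventually_ge_atTop m, hlim.eventually
    (gt_mem_nhds (show c + |y m| * 0 < c + η by linarith))]
    with k hk h
  exact (hbound k hk).trans h.le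

/-- Deterministic core of asynchronous stochastic approximation for a sup-norm contraction: if the
weighted noise is summable along every coordinate, the error tends to zero. -/
theorem tendsto_norm_zero_of_async_contraction {ι : Type*} [Fintype ι] {x : ℕ → ι → ℝ} {γ C : ℝ}
    (hγ : 0 ≤ γ) (hγ1 : γ < 1) (hC : ∀ k, ‖x k‖ ≤ C)
    (h : ∀ i, (∀ k, x k i = 0) ∨ ∃ α F w : ℕ → ℝ, (∀ k, 0 ≤ α k) ∧ (∀ᶠ k in atTop, α k ≤ 1) ∧
      Tendsto (fun n => ∑ k ∈ Finset.range n, α k) atTop atTop ∧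
      (∀ k, |F k| ≤ γ * ‖x k‖) ∧
      (∃ u, Tendsto (fun n => ∑ k ∈ Finset.range n, α k * w k) atTop (𝓝 u)) ∧
      ∀ k, x (k + 1) i = x k i + α k * (F k + w k - x k i)) :
    Tendsto (fun k => ‖x k‖) atTop (𝓝 0) := by
  have improve : ∀ D η : ℝ, 0 ≤ D → 0 < η → (∀ᶠ k in atTop, ‖x k‖ ≤ D) →
      ∀ᶠ k in atTop, ‖x k‖ ≤ γ * D + η := by
    intro D η hD hη hev
    have hcoord : ∀ i, ∀ᶠ k in atTop, |x k i| ≤ γ * D + η := by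
      intro i
      rcases h i with h0 | ⟨α, F, w, hα, hα1, hαs, hF, ⟨u, hu⟩, hrec⟩
      · refine Eventually.of_forall fun k => ?_
        rw [h0, abs_zero]
        positivity
      -- v is minus the tail of the noise series, hence tends to 0. The difference x - v solves the
      -- same recursion without noise, with target F - v.
      set v : ℕ → ℝ := fun n => ∑ k ∈ Finset.range n, α k * w k - u with hv
      have hv0 : Tendsto v atTop (𝓝 0) := by simpa [hv] using hu.sub_const u
      have hvs : ∀ᶠ k in atTop, |v k| < η / 3 := by
        have := hv0.abs
        rw [abs_zero] at this
        exact this.eventually (gt_mem_nhds (by positivity))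
      have hy := eventually_abs_le_of_averaging (y := fun k => x k i - v k) (α := α)
        (δ := fun k => F k - v k) (c := γ * D + η / 3) (η := η / 3) hα hα1 hαs
        (fun k => by
          simp only [hv, Finset.sum_range_succ, hrec k]
          ring)
        (by
          filter_upwards [hev, hvs] with k h1 h2
          calc |F k - v k| ≤ |F k| + |v k| := abs_sub _ _
            _ ≤ γ * D + η / 3 :=
              add_le_add ((hF k).trans (mul_le_mul_of_nonneg_left h1 hγ)) h2.le)
        (by positivity)
      filter_upwards [hy, hvs] with k h1 h2
      calc |x k i| = |(x k i - v k) + v k| := by rw [sub_add_cancel]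
        _ ≤ |x k i - v k| + |v k| := abs_add_le _ _
        _ ≤ γ * D + η := by linarith
    filter_upwards [eventually_all.2 hcoord] with k hk
    exact (pi_norm_le_iff_of_nonneg (by positivity)).2 hk
  have hC0 : 0 ≤ C := (norm_nonneg _).trans (hC 0)
  -- The slack η = (1 - γ)/2 · D turns γD + η into θD with θ < 1. Starting from C + 1 rather than C
  -- keeps D, and hence η, positive.
  set θ : ℝ := (1 + γ) / 2 with hθ
  have hiter : ∀ n : ℕ, ∀ᶠ k in atTop, ‖x k‖ ≤ θ ^ n * (C + 1) := by
    intro n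
    induction n with
    | zero => exact Eventually.of_forall fun k => by linarith [hC k]
    | succ n ih =>
      have hpos : 0 < θ ^ n * (C + 1) := by positivity
      have := improve _ ((1 - γ) / 2 * (θ ^ n * (C + 1))) hpos.le
        (mul_pos (by linarith) hpos) ih
      filter_upwards [this] with k hk
      refine hk.trans_eq ?_
      rw [pow_succ, hθ]
      ring
  have hθlim : Tendsto (fun n : ℕ => θ ^ n * (C + 1)) atTop (𝓝 0) := by
    simpa using (tendsto_pow_atTop_nhds_zero_of_lt_one (by positivity)
      (by rw [hθ]; linarith : θ < 1)).mul_const (C + 1)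
  refine Metric.tendsto_nhds.2 fun r hr => ?_
  obtain ⟨n, hn⟩ := (hθlim.eventually (gt_mem_nhds hr)).exists
  filter_upwards [hiter n] with k hk
  rw [Real.dist_eq, sub_zero, abs_norm]
  exact hk.trans_lt hn

/-! ### Almost sure convergence of martingale series -/

/-- A series of martingale differences whose sums of squares are uniformly bounded converges
almost surely. -/
theorem ae_exists_tendsto_sum_of_condExp_eq_zero {Ω : Type*} {mΩ : MeasurableSpace Ω}
    {μ : Measure Ω} [IsProbabilityMeasure μ] {ℱ : Filtration ℕ mΩ} {ξ : ℕ → Ω → ℝ} {C : ℝ}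
    (hmeas : ∀ n, Measurable[ℱ (n + 1)] (ξ n)) (hzero : ∀ n, μ[ξ n | ℱ n] =ᵐ[μ] 0)
    (hsq : ∀ n ω, ∑ k ∈ Finset.range n, ξ k ω ^ 2 ≤ C) :
    ∀ᵐ ω ∂μ, ∃ u, Tendsto (fun n => ∑ k ∈ Finset.range n, ξ k ω) atTop (𝓝 u) := by
  -- A single square is at most C, and 2|ξ| ≤ ξ² + 1.
  have hξC : ∀ n ω, |ξ n ω| ≤ C + 1 := fun n ω => by
    have h1 := hsq (n + 1) ω
    rw [Finset.sum_range_succ] at h1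
    have h2 : 0 ≤ ∑ k ∈ Finset.range n, ξ k ω ^ 2 := Finset.sum_nonneg fun _ _ => sq_nonneg _
    nlinarith [sq_abs (ξ n ω), sq_nonneg (|ξ n ω| - 1), abs_nonneg (ξ n ω)]
  set Z : ℕ → Ω → ℝ := fun n ω => ∑ k ∈ Finset.range n, ξ k ω with hZ
  have hZm : ∀ n, Measurable[ℱ n] (Z n) := fun n =>
    Finset.measurable_sum _ fun k hk =>
      (hmeas k).mono (ℱ.mono (Finset.mem_range.1 hk)) le_rfl
  have hZC : ∀ n ω, |Z n ω| ≤ n * (C + 1) := fun n ω => by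
    refine (Finset.abs_sum_le_sum_abs _ _).trans ?_
    refine (Finset.sum_le_sum fun k _ => hξC k ω).trans_eq ?_
    rw [Finset.sum_const, Finset.card_range, nsmul_eq_mul]
  have bdd : ∀ {f : Ω → ℝ} (B : ℝ), Measurable f → (∀ ω, |f ω| ≤ B) → Integrable f μ :=
    fun B hf hB => Integrable.of_bound hf.aestronglyMeasurable B (Eventually.of_forall hB)
  have hξmΩ : ∀ n, Measurable (ξ n) := fun n => (hmeas n).mono (ℱ.le _) le_rfl
  have hZmΩ : ∀ n, Measurable (Z n) := fun n => (hZm n).mono (ℱ.le _) le_rfl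
  have hξi : ∀ n, Integrable (ξ n) μ := fun n => bdd _ (hξmΩ n) (hξC n)
  have hZi : ∀ n, Integrable (Z n) μ := fun n => bdd _ (hZmΩ n) (hZC n)
  have hprod : ∀ n, Integrable (Z n * ξ n) μ := fun n =>
    bdd (n * (C + 1) * (C + 1)) ((hZmΩ n).mul (hξmΩ n)) fun ω => by
      rw [Pi.mul_apply, abs_mul]
      exact mul_le_mul (hZC n ω) (hξC n ω) (abs_nonneg _) ((abs_nonneg _).trans (hZC n ω))
  have hξsq : ∀ n, Integrable (fun ω => ξ n ω ^ 2) μ := fun n =>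
    bdd ((C + 1) ^ 2) ((hξmΩ n).pow_const 2) fun ω => by
      rw [abs_pow]
      exact pow_le_pow_left₀ (abs_nonneg _) (hξC n ω) 2
  have hZsq : ∀ n, Integrable (fun ω => Z n ω ^ 2) μ := fun n =>
    bdd ((n * (C + 1)) ^ 2) ((hZmΩ n).pow_const 2) fun ω => by
      rw [abs_pow]
      exact pow_le_pow_left₀ (abs_nonneg _) (hZC n ω) 2
  have hsucc : ∀ n, Z (n + 1) - Z n = ξ n := fun n => by
    funext ω
    simp [hZ, Finset.sum_range_succ]
  have hmart : Martingale Z ℱ μ :=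
    martingale_of_condExp_sub_eq_zero_nat (fun n => (hZm n).stronglyMeasurable) hZi fun n => by
      rw [hsucc]
      exact hzero n
  -- Z n is known at time n and ξ n is centred given that past, so increments are orthogonal and
  -- E[Z²] is the expected sum of squares.
  have horth : ∀ n, ∫ ω, Z n ω * ξ n ω ∂μ = 0 := fun n => by
    have h1 := condExp_mul_of_stronglyMeasurable_left (μ := μ) (hZm n).stronglyMeasurable
      (hprod n) (hξi n)
    have h2 := integral_condExp (μ := μ) (f := Z n * ξ n) (ℱ.le n)
    have h3 : ∫ ω, (μ[Z n * ξ n | ℱ n]) ω ∂μ = 0 := by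
      refine integral_eq_zero_of_ae ?_
      filter_upwards [h1, hzero n] with ω h h'
      rw [h, Pi.mul_apply, h', Pi.zero_apply, mul_zero]
    rw [h2] at h3
    exact h3
  have hL2 : ∀ n, ∫ ω, Z n ω ^ 2 ∂μ = ∫ ω, ∑ k ∈ Finset.range n, ξ k ω ^ 2 ∂μ := by
    intro n
    induction n with
    | zero => simp [hZ]
    | succ n ih =>
      have e : ∀ ω, Z (n + 1) ω ^ 2 = Z n ω ^ 2 + (2 * (Z n ω * ξ n ω) + ξ n ω ^ 2) := fun ω => by
        simp only [hZ, Finset.sum_range_succ]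
        ring
      simp_rw [e, Finset.sum_range_succ]
      have hp2 : Integrable (fun ω => 2 * (Z n ω * ξ n ω)) μ := (hprod n).const_mul 2
      have hp3 : Integrable (fun ω => 2 * (Z n ω * ξ n ω) + ξ n ω ^ 2) μ := hp2.add (hξsq n)
      rw [integral_add (hZsq n) hp3, integral_add hp2 (hξsq n),
        integral_const_mul, horth,
        integral_add (integrable_finsetSum _ fun k _ => hξsq k) (hξsq n), ih]
      ring
  have hL2C : ∀ n, ∫ ω, Z n ω ^ 2 ∂μ ≤ C := fun n => by
    rw [hL2]
    refine (integral_mono (integrable_finsetSum _ fun k _ => hξsq k)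
      (integrable_const C) (hsq n)).trans_eq ?_
    simp
  -- The convergence theorem asks for an L¹ bound, obtained from the L² bound through |Z| ≤ 1 + Z².
  refine hmart.submartingale.exists_ae_tendsto_of_bdd (R := (1 + C).toNNReal) fun n => ?_
  rw [eLpNorm_one_eq_lintegral_enorm, ← ofReal_integral_norm_eq_lintegral_enorm (hZi n)]
  refine ENNReal.ofReal_le_ofReal ?_
  have : ∫ ω, ‖Z n ω‖ ∂μ ≤ ∫ ω, (1 + Z n ω ^ 2) ∂μ := by
    refine integral_mono (hZi n).norm ((integrable_const 1).add (hZsq n)) fun ω => ?_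
    simp only [Real.norm_eq_abs]
    nlinarith [sq_abs (Z n ω), sq_nonneg (|Z n ω| - 1), abs_nonneg (Z n ω)]
  rw [integral_add (integrable_const 1) (hZsq n)] at this
  simp only [integral_const, probReal_univ, smul_eq_mul, mul_one] at this
  linarith [hL2C n]

theorem tendsto_zero_of_summable_sq {β : ℕ → ℝ} (hβ : ∀ n, 0 ≤ β n)
    (hβ_sq : Summable fun n => β n ^ 2) : Tendsto β atTop (𝓝 0) := by
  have h := (Real.continuous_sqrt.tendsto 0).comp hβ_sq.tendsto_atTop_zero
  rw [Real.sqrt_zero] at h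
  exact h.congr fun n => Real.sqrt_sq (hβ n)

/-! ### Bellman estimates and terminal states -/

namespace CvarMDP

noncomputable section

variable {S A : Type*} [Fintype S]

theorem abs_sum_stdSimplex_mul_le (p : stdSimplex ℝ S) {f : S → ℝ} {c : ℝ} (h : ∀ y, |f y| ≤ c) :
    |∑ y, p y * f y| ≤ c := by
  calc |∑ y, p y * f y| ≤ ∑ y, |p y * f y| := Finset.abs_sum_le_sum_abs _ _
    _ ≤ ∑ y, p y * c := Finset.sum_le_sum fun y _ => by
        have hp : 0 ≤ p y := p.2.1 y
        rw [abs_mul, abs_of_nonneg hp]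
        exact mul_le_mul_of_nonneg_left (h y) hp
    _ = c := by rw [← Finset.sum_mul, stdSimplex.sum_eq_one, one_mul]

theorem lookahead_of_absorbing (M : CvarMDP S A) (K : ℕ+) (e : Rounding) {t : S}
    (ht : ∀ a, M.r t a = 0 ∧ (M.P t a) t = 1)
    (v : S × M.grid K → ℝ) (z : M.grid K) (a : A) :
    M.lookahead K e v (t, z, a) = M.γ * v (t, M.nextBudget K e t z a) := by
  classical
  have hP : ∀ y, y ≠ t → (M.P t a) y = 0 := by
    intro y hy
    have hsum : ∑ y, (M.P t a) y = 1 := stdSimplex.sum_eq_one _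
    rw [← Finset.add_sum_erase _ _ (Finset.mem_univ t), (ht a).2] at hsum
    have h0 : ∑ y ∈ Finset.univ.erase t, (M.P t a) y = 0 := by linarith
    exact (Finset.sum_eq_zero_iff_of_nonneg fun y _ => (M.P t a).2.1 y).1 h0 y
      (Finset.mem_erase.2 ⟨hy, Finset.mem_univ _⟩)
  simp only [lookahead, augReward, (ht a).1, zero_add, sub_self]
  rw [Finset.sum_eq_single t (fun y _ hy => by rw [hP y hy, zero_mul])
    (fun h => absurd (Finset.mem_univ _) h), (ht a).2, one_mul]

variable [Fintype A] [Nonempty A]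

theorem abs_maxAction_sub_le {f g : A → ℝ} {c : ℝ} (h : ∀ a, |f a - g a| ≤ c) :
    |maxAction f - maxAction g| ≤ c := by
  rw [abs_sub_le_iff]
  constructor
  · exact sub_le_iff_le_add'.2 (maxAction_le_add fun a => by linarith [(abs_le.1 (h a)).2])
  · exact sub_le_iff_le_add'.2 (maxAction_le_add fun a => by linarith [(abs_le.1 (h a)).1])

theorem maxAction_zero : maxAction (fun _ : A => (0 : ℝ)) = 0 := Finset.sup'_const _ _

theorem abs_maxAction_le {f : A → ℝ} {c : ℝ} (h : ∀ a, |f a| ≤ c) : |maxAction f| ≤ c := by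
  have := abs_maxAction_sub_le (f := f) (g := fun _ => 0) (c := c) (by simpa using h)
  rwa [maxAction_zero, sub_zero] at this

theorem maxAction_optQ (M : CvarMDP S A) (K : ℕ+) (e : Rounding) (y : S) (z : M.grid K) :
    maxAction (fun a => M.optQ K e (y, z, a)) = M.optValue K e (y, z) :=
  congrFun ((M.bellman_eq_self_iff K e _).2 rfl) (y, z)

section Terminal

variable (M : CvarMDP S A) (K : ℕ+) (e : Rounding) {t : S}

/-- The budget still moves at an absorbing state, so the value is treated as a function f of z. The
Bellman equation without reward gives ‖f‖ ≤ γ‖f‖, which forces f = 0. -/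
theorem optValue_of_absorbing (ht : ∀ a, M.r t a = 0 ∧ (M.P t a) t = 1) (z : M.grid K) :
    M.optValue K e (t, z) = 0 := by
  set f : M.grid K → ℝ := fun z => M.optValue K e (t, z) with hf
  have h : ‖f‖ ≤ M.γ * ‖f‖ := by
    refine (pi_norm_le_iff_of_nonneg (mul_nonneg M.γ_pos.le (norm_nonneg _))).2 fun z => ?_
    simp only [hf]
    rw [← maxAction_optQ, Real.norm_eq_abs]
    refine abs_maxAction_le fun a => ?_
    rw [optQ, M.lookahead_of_absorbing K e ht, abs_mul, abs_of_pos M.γ_pos]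
    exact mul_le_mul_of_nonneg_left (norm_le_pi_norm f _) M.γ_pos.le
  have h0 : ‖f‖ = 0 := by nlinarith [M.γ_lt_one, norm_nonneg f]
  exact congrFun (norm_eq_zero.1 h0) z

theorem optQ_of_absorbing (ht : ∀ a, M.r t a = 0 ∧ (M.P t a) t = 1) (z : M.grid K) (a : A) :
    M.optQ K e (t, z, a) = 0 := by
  rw [optQ, M.lookahead_of_absorbing K e ht, M.optValue_of_absorbing K e ht, mul_zero]

end Terminal

/-! ### Error recursion of the table along one trajectory -/

section Recursion

variable (M : CvarMDP S A) (K : ℕ+) (e : Rounding) (β : ℕ → ℝ) (s : ℕ → S) (a : ℕ → A) (s' : ℕ → S)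

open Classical in
/-- The step size with which the entries `(x, ·, b)` of the table are moved at step `k`; it
vanishes when `(x, b)` is not the current state-action pair. -/
def stepSize (k : ℕ) (x : S) (b : A) : ℝ :=
  if s k = x ∧ a k = b then β ((M.learner K e β s a s' k).N x b) else 0

/-- The value of the best action in the table `q` at the state `y` and the budget following `x`. -/
def nextValue (q : S × M.grid K × A → ℝ) (x : S × M.grid K × A) (y : S) : ℝ :=
  maxAction fun a' => q (y, M.nextBudget K e x.1 x.2.1 x.2.2, a')

/-- The deviation of the sampled update target from its conditional mean. -/
def noise (k : ℕ) (x : S × M.grid K × A) : ℝ :=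
  M.γ * (M.nextValue K e (M.learner K e β s a s' k).q x (s' k)
    - ∑ y, (M.P x.1 x.2.2) y * M.nextValue K e (M.learner K e β s a s' k).q x y)

/-- The deviation of the mean update target from the optimal action value. -/
def drift (q : S × M.grid K × A → ℝ) (x : S × M.grid K × A) : ℝ :=
  M.γ * ∑ y, (M.P x.1 x.2.2) y * (M.nextValue K e q x y - M.nextValue K e (M.optQ K e) x y)

open Classical in
theorem learner_N_succ (k : ℕ) (x : S) (b : A) :
    (M.learner K e β s a s' (k + 1)).N x b =
      if s k = x ∧ a k = b then (M.learner K e β s a s' k).N x b + 1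
      else (M.learner K e β s a s' k).N x b := by
  simp only [learner, Learner.step, eq_comm]

theorem learner_q_succ (k : ℕ) (x : S × M.grid K × A) :
    (M.learner K e β s a s' (k + 1)).q x = (M.learner K e β s a s' k).q x
      + M.stepSize K e β s a s' k x.1 x.2.2 * (M.augReward x.1 x.2.1 x.2.2
        + M.γ * M.nextValue K e (M.learner K e β s a s' k).q x (s' k)
        - (M.learner K e β s a s' k).q x) := by
  obtain ⟨x, z, b⟩ := x
  by_cases h : s k = x ∧ a k = b
  · obtain ⟨rfl, rfl⟩ := h
    simp [learner, Learner.step, stepSize, nextValue]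
  · have h' : ¬ (x = s k ∧ b = a k) := fun ⟨h1, h2⟩ => h ⟨h1.symm, h2.symm⟩
    simp [learner, Learner.step, stepSize, h, h']

theorem stepSize_nonneg (hβ : ∀ n, 0 ≤ β n) (k : ℕ) (x : S) (b : A) :
    0 ≤ M.stepSize K e β s a s' k x b := by
  unfold stepSize
  split_ifs
  exacts [hβ _, le_rfl]

theorem abs_drift_le (q : S × M.grid K × A → ℝ) (x : S × M.grid K × A) :
    |M.drift K e q x| ≤ M.γ * ‖q - M.optQ K e‖ := by
  rw [drift, abs_mul, abs_of_pos M.γ_pos]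
  refine mul_le_mul_of_nonneg_left ?_ M.γ_pos.le
  refine abs_sum_stdSimplex_mul_le _ fun y => abs_maxAction_sub_le fun b => ?_
  exact norm_le_pi_norm (q - M.optQ K e) _

/-- This puts the update in stochastic approximation form: subtracting the fixed-point equation of
`optQ` cancels the reward and splits the target into a contracting drift and a centred noise. -/
theorem learner_error_succ (k : ℕ) (x : S × M.grid K × A) :
    ((M.learner K e β s a s' (k + 1)).q - M.optQ K e) x =
      ((M.learner K e β s a s' k).q - M.optQ K e) x
      + M.stepSize K e β s a s' k x.1 x.2.2 * (M.drift K e (M.learner K e β s a s' k).q x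
        + M.noise K e β s a s' k x - ((M.learner K e β s a s' k).q - M.optQ K e) x) := by
  have hopt : M.optQ K e x = M.augReward x.1 x.2.1 x.2.2
      + M.γ * ∑ y, (M.P x.1 x.2.2) y * M.nextValue K e (M.optQ K e) x y := by
    simp only [nextValue, maxAction_optQ]
    rfl
  have hdrift : M.drift K e (M.learner K e β s a s' k).q x =
      M.γ * ∑ y, (M.P x.1 x.2.2) y * M.nextValue K e (M.learner K e β s a s' k).q x y
      - M.γ * ∑ y, (M.P x.1 x.2.2) y * M.nextValue K e (M.optQ K e) x y := by
    simp only [drift, mul_sub, Finset.sum_sub_distrib]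
  simp only [Pi.sub_apply]
  rw [learner_q_succ, hdrift, hopt, noise]
  ring

open Classical in
/-- Summing along the visits of `(x, b)` is summing over the visit numbers. -/
theorem sum_visits (φ : ℕ → ℝ) (n : ℕ) (x : S) (b : A) :
    ∑ k ∈ Finset.range n,
        (if s k = x ∧ a k = b then φ ((M.learner K e β s a s' k).N x b) else 0)
      = ∑ j ∈ Finset.range ((M.learner K e β s a s' n).N x b), φ j := by
  induction n with
  | zero => simp [learner]
  | succ n ih =>
    rw [Finset.sum_range_succ, ih, learner_N_succ]
    split_ifs
    · rw [Finset.sum_range_succ]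
    · rw [add_zero]

theorem sum_stepSize (n : ℕ) (x : S) (b : A) :
    ∑ k ∈ Finset.range n, M.stepSize K e β s a s' k x b
      = ∑ j ∈ Finset.range ((M.learner K e β s a s' n).N x b), β j :=
  M.sum_visits K e β s a s' β n x b

/-- Each visit number of (x, b) is used once, so the bound does not depend on the trajectory, as the
martingale argument requires. -/
theorem sum_stepSize_sq_le (hβ_sq : Summable fun n => β n ^ 2) (n : ℕ) (x : S) (b : A) :
    ∑ k ∈ Finset.range n, M.stepSize K e β s a s' k x b ^ 2 ≤ ∑' j, β j ^ 2 := by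
  refine le_trans (le_of_eq ?_) (hβ_sq.sum_le_tsum
    (Finset.range ((M.learner K e β s a s' n).N x b)) fun _ _ => sq_nonneg _)
  rw [← M.sum_visits K e β s a s' (fun j => β j ^ 2)]
  refine Finset.sum_congr rfl fun k _ => ?_
  unfold stepSize
  split_ifs <;> simp

/-- An update at t carries no reward and reads only entries at t again, so the zero initial values
are preserved. -/
theorem learner_q_eq_zero {t : S} (ht : ∀ a, M.r t a = 0 ∧ (M.P t a) t = 1)
    (hs : ∀ k, s k = t → s' k = t) (k : ℕ) (z : M.grid K) (b : A) :
    (M.learner K e β s a s' k).q (t, z, b) = 0 := by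
  induction k generalizing z b with
  | zero => rfl
  | succ k ih =>
    rw [learner_q_succ, ih, zero_add, sub_zero]
    by_cases h : s k = t
    · rw [hs k h]
      simp [nextValue, ih, maxAction_zero, augReward, (ht b).1]
    · simp [stepSize, h]

end Recursion

/-! ### Uniform boundedness of the table -/

/-- The table stays in a bounded set that does not depend on the observed trajectory. -/
theorem exists_learner_q_bound (M : CvarMDP S A) (K : ℕ+) (e : Rounding) {β : ℕ → ℝ}
    (hβ : ∀ n, 0 ≤ β n) (hβ_lim : Tendsto β atTop (𝓝 0)) :
    ∃ C, 0 ≤ C ∧ ∀ s a s' k x, |(M.learner K e β s a s' k).q x| ≤ C := by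
  classical
  obtain ⟨n₀, hn₀⟩ := eventually_atTop.1 (hβ_lim.eventually (gt_mem_nhds one_pos))
  obtain ⟨B, hB⟩ := hβ_lim.bddAbove_range
  have hB : ∀ n, β n ≤ B := fun n => hB ⟨n, rfl⟩
  have hB0 : 0 ≤ B := (hβ 0).trans (hB 0)
  obtain ⟨R, hR⟩ := (Set.finite_range fun x : S × M.grid K × A =>
    |M.augReward x.1 x.2.1 x.2.2|).bddAbove
  have hR : ∀ x : S × M.grid K × A, |M.augReward x.1 x.2.1 x.2.2| ≤ max R 0 := fun x =>
    (hR ⟨x, rfl⟩).trans (le_max_left _ _)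
  have hγ : 0 < 1 - M.γ := sub_pos.2 M.γ_lt_one
  -- V solves V = max R 0 + γV, so a table bounded by some D ≥ V produces targets bounded by D.
  set V : ℝ := max R 0 / (1 - M.γ) with hV
  have hV0 : 0 ≤ V := div_nonneg (le_max_right _ _) hγ.le
  have hRV : max R 0 = (1 - M.γ) * V := (mul_div_cancel₀ _ hγ.ne').symm
  -- A step b > 1 enlarges the bound by at most |1 - b| + b = 2b - 1 ≤ 1 + 2B; a step b ≤ 1 is a
  -- convex combination and does not enlarge it.
  set c : ℝ := 1 + 2 * B with hc
  have hc1 : 1 ≤ c := by linarith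
  refine ⟨V * c ^ (∑ _p : S × A, n₀), by positivity, fun s a s' k x => ?_⟩
  -- E counts visits, capped at n₀ for each pair. From visit number n₀ on, β < 1, so each enlarging
  -- step raises E by one, and E never exceeds n₀ times the number of pairs.
  set E : ℕ → ℕ := fun k => ∑ p : S × A, min ((M.learner K e β s a s' k).N p.1 p.2) n₀ with hE
  have hNmono : ∀ k x b, (M.learner K e β s a s' k).N x b ≤
      (M.learner K e β s a s' (k + 1)).N x b := fun k x b => by
    rw [learner_N_succ]
    split_ifs <;> omega
  have hEmono : ∀ k, E k ≤ E (k + 1) := fun k =>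
    Finset.sum_le_sum fun p _ => min_le_min_right _ (hNmono k p.1 p.2)
  have hmain : ∀ k x, |(M.learner K e β s a s' k).q x| ≤ V * c ^ E k := by
    intro k
    induction k with
    | zero =>
      intro x
      simp only [learner, abs_zero]
      positivity
    | succ k ih =>
      intro x
      set D : ℝ := V * c ^ E k with hD
      have hVD : V ≤ D := le_mul_of_one_le_right hV0 (one_le_pow₀ hc1)
      have hDD : D ≤ V * c ^ E (k + 1) :=
        mul_le_mul_of_nonneg_left (pow_le_pow_right₀ hc1 (hEmono k)) hV0
      by_cases h : s k = x.1 ∧ a k = x.2.2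
      · have hα : M.stepSize K e β s a s' k x.1 x.2.2
            = β ((M.learner K e β s a s' k).N x.1 x.2.2) := if_pos h
        set b : ℝ := β ((M.learner K e β s a s' k).N x.1 x.2.2) with hb
        have hb0 : 0 ≤ b := hβ _
        have hy : |M.nextValue K e (M.learner K e β s a s' k).q x (s' k)| ≤ D :=
          abs_maxAction_le fun _ => ih _
        have htarget : |M.augReward x.1 x.2.1 x.2.2
            + M.γ * M.nextValue K e (M.learner K e β s a s' k).q x (s' k)| ≤ D := by
          refine (abs_add_le _ _).trans ?_
          rw [abs_mul, abs_of_pos M.γ_pos]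
          have h1 := hR x
          have h2 := mul_le_mul_of_nonneg_left hy M.γ_pos.le
          have h3 := mul_le_mul_of_nonneg_left hVD hγ.le
          linarith
        have hq : |(M.learner K e β s a s' (k + 1)).q x| ≤ |1 - b| * D + b * D := by
          rw [learner_q_succ, hα]
          calc _ = |(1 - b) * (M.learner K e β s a s' k).q x + b * (M.augReward x.1 x.2.1 x.2.2
                + M.γ * M.nextValue K e (M.learner K e β s a s' k).q x (s' k))| := by
                congr 1
                ring
            _ ≤ _ := by
                refine (abs_add_le _ _).trans ?_
                rw [abs_mul, abs_mul, abs_of_nonneg hb0]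
                exact add_le_add (mul_le_mul_of_nonneg_left (ih x) (abs_nonneg _))
                  (mul_le_mul_of_nonneg_left htarget hb0)
        rcases le_or_gt b 1 with hb1 | hb1
        · rw [abs_of_nonneg (sub_nonneg.2 hb1)] at hq
          linarith
        · have hlt : (M.learner K e β s a s' k).N x.1 x.2.2 < n₀ := by
            by_contra hge
            exact (hn₀ _ (not_lt.1 hge)).not_gt hb1
          have hE1 : E k + 1 ≤ E (k + 1) := by
            refine Finset.sum_lt_sum
              (fun p _ => min_le_min_right _ (hNmono k p.1 p.2))
              ⟨(x.1, x.2.2), Finset.mem_univ _, ?_⟩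
            simp only [learner_N_succ, if_pos h]
            omega
          have hcD : c * D ≤ V * c ^ E (k + 1) := by
            refine le_trans (le_of_eq ?_)
              (mul_le_mul_of_nonneg_left (pow_le_pow_right₀ hc1 hE1) hV0)
            rw [hD, pow_succ]
            ring
          have hbB : b ≤ B := hB _
          have hD0 : 0 ≤ D := hV0.trans hVD
          rw [abs_of_nonpos (show 1 - b ≤ 0 by linarith)] at hq
          refine (hq.trans ?_).trans hcD
          rw [← add_mul]
          exact mul_le_mul_of_nonneg_right (by linarith) hD0
      · have hα : M.stepSize K e β s a s' k x.1 x.2.2 = 0 := if_neg h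
        rw [learner_q_succ, hα, zero_mul, add_zero]
        exact (ih x).trans hDD
  refine (hmain k x).trans (mul_le_mul_of_nonneg_left (pow_le_pow_right₀ hc1 ?_) hV0)
  exact Finset.sum_le_sum fun p _ => min_le_right _ _

theorem abs_noise_le {M : CvarMDP S A} {K : ℕ+} {e : Rounding} {β : ℕ → ℝ} {s : ℕ → S}
    {a : ℕ → A} {s' : ℕ → S} {C : ℝ} {k : ℕ} (hC : ∀ x, |(M.learner K e β s a s' k).q x| ≤ C)
    (x : S × M.grid K × A) : |M.noise K e β s a s' k x| ≤ 2 * C := by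
  have hv : ∀ y, |M.nextValue K e (M.learner K e β s a s' k).q x y| ≤ C := fun y =>
    abs_maxAction_le fun _ => hC _
  have h := (abs_sub _ _).trans (add_le_add (hv (s' k))
    (abs_sum_stdSimplex_mul_le (M.P x.1 x.2.2) hv))
  rw [noise, abs_mul, abs_of_pos M.γ_pos]
  refine (mul_le_of_le_one_left (abs_nonneg _) M.γ_lt_one.le).trans ?_
  linarith

end

end CvarMDP

/-! ### Measurability and conditional centring -/

theorem measurable_apply_of_finite {Ω S : Type*} {m : MeasurableSpace Ω} [MeasurableSpace S]
    [MeasurableSingletonClass S] [Finite S] {g : S → Ω → ℝ} {f : Ω → S}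
    (hg : ∀ y, Measurable (g y)) (hf : Measurable f) : Measurable fun ω => g (f ω) ω :=
  (measurable_from_prod_countable_right (f := fun p : S × Ω => g p.1 p.2) hg).comp
    (hf.prodMk measurable_id)

/-- An indicator minus its conditional expectation stays centred when multiplied by a bounded
function that is measurable for the conditioning σ-algebra. -/
theorem condExp_mul_indicator_sub_eq_zero {Ω : Type*} {m mΩ : MeasurableSpace Ω} {μ : Measure Ω}
    [IsProbabilityMeasure μ] (hm : m ≤ mΩ) {E : Set Ω} (hE : MeasurableSet E) {c p : Ω → ℝ} {C : ℝ}
    (hc : Measurable[m] c) (hcC : ∀ ω, |c ω| ≤ C) (hp : Measurable[m] p) (hpi : Integrable p μ)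
    (hEp : μ[E.indicator (fun _ => (1 : ℝ)) | m] =ᵐ[μ] p) :
    Integrable (c * (E.indicator (fun _ => (1 : ℝ)) - p)) μ ∧
      μ[c * (E.indicator (fun _ => (1 : ℝ)) - p) | m] =ᵐ[μ] 0 := by
  have h1 : Integrable (E.indicator (fun _ => (1 : ℝ))) μ := (integrable_const 1).indicator hE
  have h2 : Integrable (E.indicator (fun _ => (1 : ℝ)) - p) μ := h1.sub hpi
  have h3 : Integrable (c * (E.indicator (fun _ => (1 : ℝ)) - p)) μ :=
    h2.bdd_mul (hc.mono hm le_rfl).aestronglyMeasurable (Eventually.of_forall hcC)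
  refine ⟨h3, ?_⟩
  filter_upwards [condExp_mul_of_stronglyMeasurable_left hc.stronglyMeasurable h3 h2,
    condExp_sub h1 hpi m, hEp] with ω e1 e2 e3
  rw [e1, Pi.mul_apply, e2, Pi.sub_apply, e3,
    condExp_of_stronglyMeasurable hm hp.stronglyMeasurable hpi, sub_self, mul_zero, Pi.zero_apply]

namespace CvarMDP

noncomputable section

variable {S A : Type*} [Fintype S] [Fintype A] [Nonempty A]

section Measurability

variable (M : CvarMDP S A) (K : ℕ+) (e : Rounding) (β : ℕ → ℝ) {Ω : Type*}
  {s : ℕ → Ω → S} {a : ℕ → Ω → A} {s' : ℕ → Ω → S} {k : ℕ}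

theorem measurable_nextValue {m : MeasurableSpace Ω} {q : Ω → S × M.grid K × A → ℝ}
    (hq : ∀ x, Measurable fun ω => q ω x) (x : S × M.grid K × A) (y : S) :
    Measurable fun ω => M.nextValue K e (q ω) x y := by
  have h := Finset.measurable_sup' (Finset.univ_nonempty (α := A))
    (f := fun a' ω => q ω (y, M.nextBudget K e x.1 x.2.1 x.2.2, a')) fun a' _ => hq _
  convert h using 1
  funext ω
  simp only [nextValue, maxAction, Finset.sup'_apply]

variable [MeasurableSpace S] [MeasurableSingletonClass S] [MeasurableSpace A]
  [MeasurableSingletonClass A]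

theorem measurable_stepSize {m : MeasurableSpace Ω} (hs : Measurable (s k)) (ha : Measurable (a k))
    {x : S} {b : A} (hN : Measurable fun ω => (M.learner K e β (s · ω) (a · ω) (s' · ω) k).N x b) :
    Measurable fun ω => M.stepSize K e β (s · ω) (a · ω) (s' · ω) k x b := by
  classical
  unfold stepSize
  exact Measurable.ite ((hs (measurableSet_singleton x)).inter (ha (measurableSet_singleton b)))
    ((measurable_of_countable β).comp hN) measurable_const

theorem measurable_learner {mΩ : MeasurableSpace Ω} {ℱ : Filtration ℕ mΩ}
    (hs : ∀ k, Measurable[ℱ k] (s k)) (ha : ∀ k, Measurable[ℱ (k + 1)] (a k))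
    (hs' : ∀ k, Measurable[ℱ (k + 1)] (s' k)) (k : ℕ) :
    (∀ x b, Measurable[ℱ k] fun ω => (M.learner K e β (s · ω) (a · ω) (s' · ω) k).N x b) ∧
    ∀ x, Measurable[ℱ k] fun ω => (M.learner K e β (s · ω) (a · ω) (s' · ω) k).q x := by
  classical
  induction k with
  | zero => exact ⟨fun _ _ => measurable_const, fun _ => measurable_const⟩
  | succ k ih =>
    have hle : ℱ k ≤ ℱ (k + 1) := ℱ.mono k.le_succ
    have hsk : Measurable[ℱ (k + 1)] (s k) := (hs k).mono hle le_rfl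
    have hN : ∀ x b, Measurable[ℱ (k + 1)] fun ω =>
        (M.learner K e β (s · ω) (a · ω) (s' · ω) k).N x b := fun x b =>
      (ih.1 x b).mono hle le_rfl
    have hq : ∀ x, Measurable[ℱ (k + 1)] fun ω =>
        (M.learner K e β (s · ω) (a · ω) (s' · ω) k).q x := fun x => (ih.2 x).mono hle le_rfl
    refine ⟨fun x b => ?_, fun x => ?_⟩
    · simp only [learner_N_succ]
      exact Measurable.ite
        ((hsk (measurableSet_singleton x)).inter (ha k (measurableSet_singleton b)))
        ((measurable_of_countable (· + 1)).comp (hN x b)) (hN x b)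
    · simp only [learner_q_succ]
      have hα := M.measurable_stepSize K e β (s' := s') hsk (ha k) (hN x.1 x.2.2)
      have hv := measurable_apply_of_finite (M.measurable_nextValue K e hq x) (hs' k)
      exact (hq x).add (hα.mul (((hv.const_mul M.γ).const_add _).sub (hq x)))

theorem measurable_noise {mΩ : MeasurableSpace Ω} {ℱ : Filtration ℕ mΩ}
    (hs : ∀ k, Measurable[ℱ k] (s k)) (ha : ∀ k, Measurable[ℱ (k + 1)] (a k))
    (hs' : ∀ k, Measurable[ℱ (k + 1)] (s' k)) (k : ℕ) (x : S × M.grid K × A) :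
    Measurable[ℱ (k + 1)] fun ω => M.noise K e β (s · ω) (a · ω) (s' · ω) k x := by
  have hq : ∀ x, Measurable[ℱ (k + 1)] fun ω =>
      (M.learner K e β (s · ω) (a · ω) (s' · ω) k).q x := fun x =>
    ((M.measurable_learner K e β hs ha hs' k).2 x).mono (ℱ.mono k.le_succ) le_rfl
  have hv := measurable_apply_of_finite (M.measurable_nextValue K e hq x) (hs' k)
  exact (hv.sub (Finset.measurable_sum _ fun y _ =>
    (M.measurable_nextValue K e hq x y).const_mul _)).const_mul _

end Measurability

/-! ### The noise along a run of the algorithm -/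

section Run

variable {M : CvarMDP S A} {K : ℕ+} {e : Rounding} {terminal : Set S} {ν : stdSimplex ℝ S}
  {ε β : ℕ → ℝ} [MeasurableSpace S] [MeasurableSpace A] {Ω : Type*} {mΩ : MeasurableSpace Ω}
  {ℙ : Measure Ω} {ℱ : Filtration ℕ mΩ} {s : ℕ → Ω → S} {z : ℕ → Ω → M.grid K}
  {a : ℕ → Ω → A} {s' : ℕ → Ω → S}

theorem IsQLearningRun.sup_comap_le (hrun : M.IsQLearningRun K e terminal ν ε β ℙ ℱ s z a s')
    (k : ℕ) : ℱ k ⊔ MeasurableSpace.comap (a k) inferInstance ≤ mΩ :=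
  sup_le (ℱ.le k) ((hrun.measurable_a k).mono (ℱ.le _) le_rfl).comap_le

variable [MeasurableSingletonClass S] [MeasurableSingletonClass A] [IsProbabilityMeasure ℙ]

/-- Bounded functions of the past and the current action are uncorrelated with the deviation of
the observed next state from its conditional law. -/
theorem IsQLearningRun.condExp_mul_transition
    (hrun : M.IsQLearningRun K e terminal ν ε β ℙ ℱ s z a s') (k : ℕ) (y : S) {c : Ω → ℝ} {C : ℝ}
    (hc : Measurable[ℱ k ⊔ MeasurableSpace.comap (a k) inferInstance] c) (hcC : ∀ ω, |c ω| ≤ C) :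
    Integrable (c * ({ω | s' k ω = y}.indicator (fun _ => (1 : ℝ))
        - fun ω => M.P (s k ω) (a k ω) y)) ℙ ∧
      ℙ[c * ({ω | s' k ω = y}.indicator (fun _ => (1 : ℝ)) - fun ω => M.P (s k ω) (a k ω) y) |
        ℱ k ⊔ MeasurableSpace.comap (a k) inferInstance] =ᵐ[ℙ] 0 := by
  have hm := hrun.sup_comap_le k
  have hsm : Measurable[ℱ k ⊔ MeasurableSpace.comap (a k) inferInstance] (s k) :=
    (hrun.measurable_s k).mono le_sup_left le_rfl
  have ham : Measurable[ℱ k ⊔ MeasurableSpace.comap (a k) inferInstance] (a k) :=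
    (comap_measurable (a k)).mono le_sup_right le_rfl
  have hp : Measurable[ℱ k ⊔ MeasurableSpace.comap (a k) inferInstance]
      fun ω => M.P (s k ω) (a k ω) y :=
    (measurable_of_countable fun p : S × A => M.P p.1 p.2 y).comp (hsm.prodMk ham)
  refine condExp_mul_indicator_sub_eq_zero hm
    ((hrun.measurable_s' k).mono (ℱ.le _) le_rfl (measurableSet_singleton y)) hc hcC hp ?_
    (hrun.transition k y)
  refine Integrable.of_bound (hp.mono hm le_rfl).aestronglyMeasurable 1
    (Eventually.of_forall fun ω => ?_)
  have h := stdSimplex.le_one (M.P (s k ω) (a k ω)) y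
  have h0 : 0 ≤ M.P (s k ω) (a k ω) y := (M.P (s k ω) (a k ω)).2.1 y
  rw [Real.norm_eq_abs, abs_of_nonneg h0]
  exact h

/-- Absorbing states are almost surely never left. -/
theorem IsQLearningRun.ae_next_eq_of_absorbing
    (hrun : M.IsQLearningRun K e terminal ν ε β ℙ ℱ s z a s') {t : S}
    (ht : ∀ a, M.r t a = 0 ∧ (M.P t a) t = 1) (k : ℕ) : ∀ᵐ ω ∂ℙ, s k ω = t → s' k ω = t := by
  classical
  set m : MeasurableSpace Ω := ℱ k ⊔ MeasurableSpace.comap (a k) inferInstance with hmdef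
  have hE : MeasurableSet[m] {ω | s k ω = t} :=
    ((hrun.measurable_s k).mono le_sup_left le_rfl) (measurableSet_singleton t)
  -- As P t a puts mass 1 on t, this sign makes the centred product the indicator of leaving t. It
  -- is nonnegative with zero integral, hence almost surely zero.
  set c : Ω → ℝ := {ω | s k ω = t}.indicator (fun _ => -1) with hc
  obtain ⟨hi, h0⟩ := hrun.condExp_mul_transition k t (c := c) (C := 1)
    (measurable_const.indicator hE) (fun ω => by
      rw [hc, Set.indicator_apply]
      split_ifs <;> simp)
  have hint := integral_condExp (μ := ℙ) (f := c * ({ω | s' k ω = t}.indicator (fun _ => (1 : ℝ))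
    - fun ω => M.P (s k ω) (a k ω) t)) (hrun.sup_comap_le k)
  rw [integral_eq_zero_of_ae h0] at hint
  have hval : ∀ ω, (c * ({ω | s' k ω = t}.indicator (fun _ => (1 : ℝ))
      - fun ω => M.P (s k ω) (a k ω) t)) ω = if s k ω = t ∧ s' k ω ≠ t then 1 else 0 := by
    intro ω
    by_cases h1 : s k ω = t <;> by_cases h2 : s' k ω = t <;>
      simp [hc, h1, h2, (ht (a k ω)).2]
  rw [eq_comm, integral_eq_zero_iff_of_nonneg (fun ω => by
    rw [hval]
    split_ifs <;> simp) hi] at hint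
  filter_upwards [hint] with ω h h1
  by_contra h2
  rw [hval, if_pos ⟨h1, h2⟩] at h
  exact one_ne_zero h

/-- The step size depends on the current action, so centring is proved given the past and `a k`,
then passed down to `ℱ k` by the tower property. -/
theorem IsQLearningRun.condExp_stepSize_mul_noise
    (hrun : M.IsQLearningRun K e terminal ν ε β ℙ ℱ s z a s') {B C : ℝ}
    (hβ : ∀ n, |β n| ≤ B)
    (hC : ∀ s a s' k x, |(M.learner K e β s a s' k).q x| ≤ C) (k : ℕ) (x : S × M.grid K × A) :
    ℙ[fun ω => M.stepSize K e β (s · ω) (a · ω) (s' · ω) k x.1 x.2.2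
        * M.noise K e β (s · ω) (a · ω) (s' · ω) k x | ℱ k] =ᵐ[ℙ] 0 := by
  classical
  have hm := hrun.sup_comap_le k
  obtain ⟨hN, hq⟩ := M.measurable_learner K e β hrun.measurable_s hrun.measurable_a
    hrun.measurable_s' k
  set m : MeasurableSpace Ω := ℱ k ⊔ MeasurableSpace.comap (a k) inferInstance with hmdef
  have hle : ℱ k ≤ m := le_sup_left
  have hα : Measurable[m] fun ω => M.stepSize K e β (s · ω) (a · ω) (s' · ω) k x.1 x.2.2 :=
    M.measurable_stepSize K e β ((hrun.measurable_s k).mono hle le_rfl)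
      ((comap_measurable (a k)).mono le_sup_right le_rfl) ((hN _ _).mono hle le_rfl)
  set c : S → Ω → ℝ := fun y ω => M.stepSize K e β (s · ω) (a · ω) (s' · ω) k x.1 x.2.2 *
    (M.γ * M.nextValue K e (M.learner K e β (s · ω) (a · ω) (s' · ω) k).q x y) with hcdef
  have hcm : ∀ y, Measurable[m] (c y) := fun y =>
    hα.mul (((M.measurable_nextValue K e hq x y).mono hle le_rfl).const_mul _)
  have hB0 : 0 ≤ B := (abs_nonneg _).trans (hβ 0)
  have hcC : ∀ y ω, |c y ω| ≤ B * (M.γ * C) := fun y ω => by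
    rw [hcdef, abs_mul, abs_mul, abs_of_pos M.γ_pos]
    refine mul_le_mul ?_ (mul_le_mul_of_nonneg_left (abs_maxAction_le fun _ => hC _ _ _ _ _)
      M.γ_pos.le) (mul_nonneg M.γ_pos.le (abs_nonneg _)) hB0
    unfold stepSize
    split_ifs
    · exact hβ _
    · simpa using hB0
  -- Expanding over the values of the next state isolates indicators minus probabilities. On a visit
  -- the law is P x.1 x.2.2; off a visit the step size kills both sides.
  have hdecomp : (fun ω => M.stepSize K e β (s · ω) (a · ω) (s' · ω) k x.1 x.2.2
      * M.noise K e β (s · ω) (a · ω) (s' · ω) k x) =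
      ∑ y, c y * ({ω | s' k ω = y}.indicator (fun _ => (1 : ℝ))
        - fun ω => M.P (s k ω) (a k ω) y) := by
    funext ω
    simp only [Finset.sum_apply, Pi.mul_apply, Pi.sub_apply, hcdef]
    by_cases h : s k ω = x.1 ∧ a k ω = x.2.2
    · simp only [h.1, h.2, noise, mul_sub, Finset.sum_sub_distrib, Set.indicator_apply,
        Set.mem_ofPred_eq, mul_ite, mul_one, mul_zero, Finset.sum_ite_eq, Finset.mem_univ, if_true,
        Finset.mul_sum]
      congr 1
      exact Finset.sum_congr rfl fun y _ => by ring
    · simp [stepSize, h]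
  rw [hdecomp]
  have hterm := fun y => hrun.condExp_mul_transition k y (hcm y) (hcC y)
  have hsum : ℙ[∑ y, c y * ({ω | s' k ω = y}.indicator (fun _ => (1 : ℝ))
        - fun ω => M.P (s k ω) (a k ω) y) | m] =ᵐ[ℙ] 0 := by
    refine (condExp_finsetSum (fun y _ => (hterm y).1) m).trans ?_
    filter_upwards [ae_all_iff.2 fun y => (hterm y).2] with ω hω
    rw [Finset.sum_apply]
    exact Finset.sum_eq_zero fun y _ => hω y
  refine (condExp_condExp_of_le hle hm).symm.trans ((condExp_congr_ae hsum).trans ?_)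
  rw [condExp_zero]

theorem IsQLearningRun.ae_exists_tendsto_sum_noise
    (hrun : M.IsQLearningRun K e terminal ν ε β ℙ ℱ s z a s') (hβ_sq : Summable fun n => β n ^ 2)
    {B C : ℝ} (hβ : ∀ n, |β n| ≤ B) (hC : ∀ s a s' k x, |(M.learner K e β s a s' k).q x| ≤ C)
    (x : S × M.grid K × A) :
    ∀ᵐ ω ∂ℙ, ∃ u, Tendsto (fun n => ∑ k ∈ Finset.range n,
      M.stepSize K e β (s · ω) (a · ω) (s' · ω) k x.1 x.2.2
        * M.noise K e β (s · ω) (a · ω) (s' · ω) k x) atTop (𝓝 u) := by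
  refine ae_exists_tendsto_sum_of_condExp_eq_zero (ℱ := ℱ) (C := (∑' j, β j ^ 2) * (2 * C) ^ 2)
    (fun k => ?_) (fun k => hrun.condExp_stepSize_mul_noise hβ hC k x) fun n ω => ?_
  · have hN := (M.measurable_learner K e β hrun.measurable_s hrun.measurable_a
      hrun.measurable_s' k).1 x.1 x.2.2
    have hle : ℱ k ≤ ℱ (k + 1) := ℱ.mono k.le_succ
    exact (M.measurable_stepSize K e β ((hrun.measurable_s k).mono hle le_rfl)
      (hrun.measurable_a k) (hN.mono hle le_rfl)).mul
      (M.measurable_noise K e β hrun.measurable_s hrun.measurable_a hrun.measurable_s' k x)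
  · calc _ ≤ ∑ k ∈ Finset.range n,
          M.stepSize K e β (s · ω) (a · ω) (s' · ω) k x.1 x.2.2 ^ 2 * (2 * C) ^ 2 := by
          refine Finset.sum_le_sum fun k _ => ?_
          rw [mul_pow]
          refine mul_le_mul_of_nonneg_left ?_ (sq_nonneg _)
          exact sq_le_sq' (abs_le.1 (abs_noise_le (hC _ _ _ k) x)).1
            (abs_le.1 (abs_noise_le (hC _ _ _ k) x)).2
      _ ≤ _ := by
          rw [← Finset.sum_mul]
          exact mul_le_mul_of_nonneg_right
            (M.sum_stepSize_sq_le K e β _ _ _ hβ_sq n x.1 x.2.2) (sq_nonneg _)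

end Run

end

end CvarMDP

/-! ### Almost sure convergence -/

theorem mainTheorem4 {S A : Type*} [Fintype S] [Fintype A] [Nonempty A]
    [MeasurableSpace S] [MeasurableSingletonClass S]
    [MeasurableSpace A] [MeasurableSingletonClass A]
    (M : CvarMDP S A) (K : ℕ+) (e : Rounding)
    -- terminal states are absorbing with zero reward (this set may be empty)
    (terminal : Set S)
    (hterminal : ∀ t ∈ terminal, ∀ a, M.r t a = 0 ∧ (M.P t a) t = 1)
    -- initial distribution of the episodes, exploration schedule, step sizes
    (ν : stdSimplex ℝ S) (hν : ∀ t ∈ terminal, ν t = 0)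
    (ε : ℕ → ℝ) (hε : ∀ k, ε k ∈ Set.Icc (0 : ℝ) 1)
    (β : ℕ → ℝ) (hβ : ∀ n, 0 ≤ β n)
    (hβ_sum : Tendsto (fun n => ∑ i ∈ Finset.range n, β i) atTop atTop)
    (hβ_sq : Summable fun n => β n ^ 2)
    -- a run of the algorithm
    {Ω : Type*} {mΩ : MeasurableSpace Ω} (ℙ : Measure Ω) [IsProbabilityMeasure ℙ]
    (ℱ : Filtration ℕ mΩ)
    (s : ℕ → Ω → S) (z : ℕ → Ω → M.grid K) (a : ℕ → Ω → A) (s' : ℕ → Ω → S)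
    (hrun : M.IsQLearningRun K e terminal ν ε β ℙ ℱ s z a s')
    -- every (non-terminal) state-action pair is visited infinitely often
    (hvisit : ∀ x ∉ terminal, ∀ b, ∀ᵐ ω ∂ℙ,
      Tendsto (fun k => (M.learner K e β (s · ω) (a · ω) (s' · ω) k).N x b) atTop atTop) :
    ∀ᵐ ω ∂ℙ,
      Tendsto (fun k => ‖(M.learner K e β (s · ω) (a · ω) (s' · ω) k).q - M.optQ K e‖)
        atTop (𝓝 0) := by
  have hβ_lim := tendsto_zero_of_summable_sq hβ hβ_sq
  obtain ⟨C, hC0, hC⟩ := M.exists_learner_q_bound K e hβ hβ_lim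
  obtain ⟨B, hB⟩ := hβ_lim.bddAbove_range
  have hβB : ∀ n, |β n| ≤ B := fun n => by
    rw [abs_of_nonneg (hβ n)]
    exact hB ⟨n, rfl⟩
  have hvisit' : ∀ᵐ ω ∂ℙ, ∀ x b, x ∉ terminal →
      Tendsto (fun k => (M.learner K e β (s · ω) (a · ω) (s' · ω) k).N x b) atTop atTop := by
    refine ae_all_iff.2 fun x => ae_all_iff.2 fun b => ?_
    by_cases hx : x ∈ terminal
    · exact Eventually.of_forall fun ω h => absurd hx h
    · filter_upwards [hvisit x hx b] with ω h _
      exact h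
  have hstay : ∀ᵐ ω ∂ℙ, ∀ t k, t ∈ terminal → s k ω = t → s' k ω = t := by
    refine ae_all_iff.2 fun t => ae_all_iff.2 fun k => ?_
    by_cases ht : t ∈ terminal
    · filter_upwards [hrun.ae_next_eq_of_absorbing (hterminal t ht) k] with ω h _
      exact h
    · exact Eventually.of_forall fun ω h => absurd h ht
  filter_upwards [hvisit', hstay,
    ae_all_iff.2 fun x => hrun.ae_exists_tendsto_sum_noise hβ_sq hβB hC x] with ω hvis hst hnoise
  refine tendsto_norm_zero_of_async_contraction (C := C + ‖M.optQ K e‖) M.γ_pos.le M.γ_lt_one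
    (fun k => (norm_sub_le _ _).trans (add_le_add_left
      ((pi_norm_le_iff_of_nonneg hC0).2 fun x => hC _ _ _ _ _) _)) fun x => ?_
  by_cases hx : x.1 ∈ terminal
  · left
    intro k
    rw [Pi.sub_apply]
    obtain ⟨t, y, b⟩ := x
    rw [M.learner_q_eq_zero K e β _ _ _ (hterminal t hx) (fun k => hst t k hx),
      M.optQ_of_absorbing K e (hterminal t hx), sub_zero]
  · right
    have hN := hvis x.1 x.2.2 hx
    refine ⟨fun k => M.stepSize K e β (s · ω) (a · ω) (s' · ω) k x.1 x.2.2,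
      fun k => M.drift K e (M.learner K e β (s · ω) (a · ω) (s' · ω) k).q x,
      fun k => M.noise K e β (s · ω) (a · ω) (s' · ω) k x,
      fun k => M.stepSize_nonneg K e β _ _ _ hβ k _ _, ?_, ?_,
      fun k => M.abs_drift_le K e _ x, hnoise x,
      fun k => M.learner_error_succ K e β _ _ _ k x⟩
    -- Infinitely many visits push the visit number to infinity, and β tends to 0, so the step sizes
    -- used are eventually below 1.
    · filter_upwards [(hβ_lim.comp hN).eventually (gt_mem_nhds one_pos)] with k hk
      unfold CvarMDP.stepSize
      split_ifs
      exacts [hk.le, zero_le_one]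
    · simp only [CvarMDP.sum_stepSize]
      exact hβ_sum.comp hN
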